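/- \textbf{Definitions.} Formulas over a finite alphabet $\Sigma$ are built from letters $p_0,p_1,\dots$ by $\bot$, $\to$ and $\Box_e$ ($e\in\Sigma$). A \emph{logic} over $\Sigma$ is a set of such formulas containing all classical tautologies and all $\Box_e(p\to q)\to(\Box_e p\to\Box_e q)$, closed under modus ponens, substitution and necessitation. A \emph{frame} $F=(W,(R_e)_{e\in\Sigma})$ has $W\neq\varnothing$ and $R_e\subseteq W\times W$; a \emph{model} adds a valuation; truth and validity are as usual in Kripke semantics. $\mathsf{Fr}(L)$ is the class of frames on which all formulas of $L$ are valid. $L$ has the \emph{finite model property} if it is the set of formulas valid on all members of some class of finite frames. $L$ is \emph{canonical} if it is valid on its canonical frame: its points are the sets $x\supseteq L$ of formulas that are closed under modus ponens and contain exactly one of $\varphi,\neg\varphi$ for each $\varphi$, and $x\,R_e\,y$ iff $\varphi\in y$ whenever $\Box_e\varphi\in x$. (The inconsistent logic, which has no such points, counts as canonical.) For a model $M=(W,(R_e),V)$ and a set $\Gamma$ of formulas, $x\sim_\Gamma y$ means that $x$ and $y$ satisfy the same formulas of $\Gamma$ in $M$; write $\hat x$ for the $\sim_\Gamma$-class of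 $x$. For $\Gamma$ finite and closed under subformulas, a \emph{strict $\Gamma$-filtration} of $M$ is a model on $W/{\sim_\Gamma}$ with relations $\hat R_e$ such that (i) a variable $p\in\Gamma$ is true at $\hat x$ iff it is true at $x$; (ii) $x\,R_e\,y$ implies $\hat x\,\hat R_e\,\hat y$; (iii) if $\hat x\,\hat R_e\,\hat y$, $\Box_e\varphi\in\Gamma$ and $M,x\models\Box_e\varphi$, then $M,y\models\varphi$. A class $\mathcal F$ of frames \emph{admits strict filtration} if, for every finite subformula-closed $\Gamma$, every model on a frame of $\mathcal F$ has a strict $\Gamma$-filtration whose frame is in $\mathcal F$. The \emph{fusion} $L_1*\dots*L_k$ of logics over finite alphabets $\Sigma_1,\dots,\Sigma_k$ (made disjoint) is the smallest logic over $\Sigma_1\cup\dots\cup\Sigma_k$ containing all $L_i$. For an alphabet $\Sigma$, let $\Sigma^\sharp$ be $\Sigma$ together with new symbols $e\circ c$, $e\cup c$, $e^+$ for all $e,c\in\Sigma$. For a logic $L$ over $\Sigma$, let $L^\sharp$ be the smallest logic over $\Sigma^\sharp$ that contains $L$ and, for all $e,c\in\Sigma$, the axioms $$\Box_{e\cup c}p\leftrightarrow\Box_e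 p\wedge\Box_c p,\quad \Box_{e\circ c}p\leftrightarrow\Box_e\Box_c p,\quad \Box_{e^+}p\to\Box_e p,\quad \Box_{e^+}p\to\Box_e\Box_{e^+}p,\quad \Box_{e^+}(p\to\Box_e p)\to(\Box_e p\to\Box_{e^+}p).$$ Put $L^{(0)}=L$ and $L^{(n+1)}=(L^{(n)})^\sharp$. \textbf{Theorem.} Let $L_1,\dots,L_k$ be canonical logics over finite alphabets such that each class $\mathsf{Fr}(L_i)$, $1\le i\le k$, admits strict filtration. Then, for every $n<\omega$, the logic $(L_1*\dots*L_k)^{(n)}$ has the finite model property. -/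

import Mathlib

namespace ModalPDL

/-! ### Formulas -/

/-- Modal formulas over an alphabet `A` of modality indices, with propositional letters
`p_0, p_1, ...` indexed by `ℕ`. -/
inductive Form (A : Type) : Type where
  | bot : Form A
  | var : ℕ → Form A
  | imp : Form A → Form A → Form A
  | box : A → Form A → Form A

namespace Form

variable {A B : Type}

/-- Negation `φ → ⊥`. -/
def neg (φ : Form A) : Form A := imp φ bot

/-- Conjunction `¬(φ → ¬ψ)`. -/
def and (φ ψ : Form A) : Form A := neg (imp φ (neg ψ))

/-- Biconditional `(φ → ψ) ∧ (ψ → φ)`. -/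
def iff (φ ψ : Form A) : Form A := and (imp φ ψ) (imp ψ φ)

/-- Uniform substitution of formulas for propositional letters. -/
def subst (σ : ℕ → Form A) : Form A → Form A
  | bot => bot
  | var p => σ p
  | imp φ ψ => imp (subst σ φ) (subst σ ψ)
  | box e φ => box e (subst σ φ)

/-- Renaming of the modalities along a map of alphabets. -/
def rename (f : A → B) : Form A → Form B
  | bot => bot
  | var p => var p
  | imp φ ψ => imp (rename f φ) (rename f ψ)
  | box e φ => box (f e) (rename f φ)

/-- The set of all subformulas of a formula, the formula itself included. -/
def subformulas : Form A → Set (Form A)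
  | bot => {bot}
  | var p => {var p}
  | imp φ ψ => {imp φ ψ} ∪ (subformulas φ ∪ subformulas ψ)
  | box e φ => {box e φ} ∪ subformulas φ

/-- Classical tautologies: formulas true under all Boolean valuations, where propositional letters
and boxed formulas are evaluated arbitrarily. -/
def IsTautology (φ : Form A) : Prop :=
  ∀ v : Form A → Prop, ¬ v bot → (∀ α β : Form A, v (imp α β) ↔ (v α → v β)) → v φ

end Form

/-- A set of formulas is `Sub`-closed if it contains all subformulas of its members. -/
def SubClosed {A : Type} (Γ : Set (Form A)) : Prop :=
  ∀ φ ∈ Γ, φ.subformulas ⊆ Γ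

/-! ### Kripke semantics -/

/-- A Kripke frame: a nonempty set with one binary relation for every index in `A`. -/
structure Frame (A : Type) : Type 1 where
  World : Type
  nonempty : Nonempty World
  rel : A → World → World → Prop

/-- A Kripke model: a frame together with a valuation. -/
structure Model (A : Type) : Type 1 where
  frame : Frame A
  val : ℕ → Set frame.World

/-- Truth of a formula at a point of a model. -/
def Model.Sat {A : Type} (M : Model A) : M.frame.World → Form A → Prop
  | _, .bot => False
  | x, .var p => x ∈ M.val p
  | x, .imp φ ψ => M.Sat x φ → M.Sat x ψ
  | x, .box e φ => ∀ y, M.frame.rel e x y → M.Sat y φ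

/-- Validity of a formula on a frame: truth at every point of every model on the frame. -/
def Frame.Valid {A : Type} (F : Frame A) (φ : Form A) : Prop :=
  ∀ (V : ℕ → Set F.World) (x : F.World), (Model.mk F V).Sat x φ

/-! ### Normal modal logics -/

/-- A normal modal logic over the alphabet `A`. -/
structure ModalLogic (A : Type) : Type where
  thms : Set (Form A)
  taut : ∀ φ : Form A, φ.IsTautology → φ ∈ thms
  axK : ∀ e : A, Form.imp (.box e (.imp (.var 0) (.var 1)))
    (.imp (.box e (.var 0)) (.box e (.var 1))) ∈ thms
  mp : ∀ φ ψ : Form A, Form.imp φ ψ ∈ thms → φ ∈ thms → ψ ∈ thms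
  subst : ∀ (σ : ℕ → Form A) (φ : Form A), φ ∈ thms → φ.subst σ ∈ thms
  nec : ∀ (e : A) (φ : Form A), φ ∈ thms → Form.box e φ ∈ thms

namespace ModalLogic

variable {A : Type}

/-- The smallest normal modal logic containing a given set of formulas. -/
def generate (S : Set (Form A)) : ModalLogic A where
  thms := {φ | ∀ L : ModalLogic A, S ⊆ L.thms → φ ∈ L.thms}
  taut φ h L _ := L.taut φ h
  axK e L _ := L.axK e
  mp φ ψ h₁ h₂ L hL := L.mp φ ψ (h₁ L hL) (h₂ L hL)
  subst σ φ h L hL := L.subst σ φ (h L hL)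
  nec e φ h L hL := L.nec e φ (h L hL)

theorem subset_generate (S : Set (Form A)) : S ⊆ (generate S).thms :=
  fun _ hφ _ hL => hL hφ

theorem generate_subset {S : Set (Form A)} {L : ModalLogic A} (h : S ⊆ L.thms) :
    (generate S).thms ⊆ L.thms :=
  fun _ hφ => hφ L h

/-- `Fr(L)`: the class of all frames on which every formula of `L` is valid. -/
def frames (L : ModalLogic A) : Set (Frame A) :=
  {F | ∀ φ ∈ L.thms, F.Valid φ}

/-- The finite model property: `L` is the logic of some class of finite frames. -/
def HasFMP (L : ModalLogic A) : Prop :=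
  ∃ C : Set (Frame A), (∀ F ∈ C, Finite F.World) ∧
    L.thms = {φ | ∀ F ∈ C, F.Valid φ}

/-- The points of the canonical frame of `L`: the consistent complete theories containing `L`. -/
structure CanonicalWorld (L : ModalLogic A) : Type where
  theory : Set (Form A)
  contains : L.thms ⊆ theory
  mp : ∀ φ ψ : Form A, Form.imp φ ψ ∈ theory → φ ∈ theory → ψ ∈ theory
  consistent : ∀ φ : Form A, ¬ (φ ∈ theory ∧ φ.neg ∈ theory)
  complete : ∀ φ : Form A, φ ∈ theory ∨ φ.neg ∈ theory

/-- The canonical frame of `L`: `x R_e y` iff `□_e φ ∈ x` implies `φ ∈ y` for all `φ`. -/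
def canonicalFrame (L : ModalLogic A) (h : Nonempty L.CanonicalWorld) : Frame A where
  World := L.CanonicalWorld
  nonempty := h
  rel e x y := ∀ φ : Form A, Form.box e φ ∈ x.theory → φ ∈ y.theory

/-- `L` is canonical if it is valid on its canonical frame. The inconsistent logic is the only one
without canonical worlds; it has no canonical frame and counts as canonical. -/
def IsCanonical (L : ModalLogic A) : Prop :=
  ∀ h : Nonempty L.CanonicalWorld, L.canonicalFrame h ∈ L.frames

end ModalLogic

/-! ### Filtrations -/

/-- The equivalence relation on the points of `M` induced by a set of formulas `Γ`:
`x ∼_Γ y` iff the same formulas of `Γ` are true at `x` and at `y`. -/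
def Model.inducedSetoid {A : Type} (M : Model A) (Γ : Set (Form A)) : Setoid M.frame.World where
  r x y := ∀ φ ∈ Γ, M.Sat x φ ↔ M.Sat y φ
  iseqv :=
    ⟨fun _ _ _ => Iff.rfl, fun h φ hφ => (h φ hφ).symm,
      fun h₁ h₂ φ hφ => (h₁ φ hφ).trans (h₂ φ hφ)⟩

/-- The minimal filtered relation for the index `e` on the quotient by `s`. -/
def Model.minRel {A : Type} (M : Model A) (s : Setoid M.frame.World) (e : A)
    (a b : Quotient s) : Prop :=
  ∃ x y, Quotient.mk s x = a ∧ Quotient.mk s y = b ∧ M.frame.rel e x y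

/-- The maximal filtered relation for the index `e` induced by `Γ` on the quotient by `s`. -/
def Model.maxRel {A : Type} (M : Model A) (Γ : Set (Form A)) (s : Setoid M.frame.World) (e : A)
    (a b : Quotient s) : Prop :=
  ∀ x y, Quotient.mk s x = a → Quotient.mk s y = b →
    ∀ φ : Form A, Form.box e φ ∈ Γ → M.Sat x (.box e φ) → M.Sat y φ

/-- A `Γ`-filtration of the model `M`: a model on the quotient of `M` by an equivalence relation of
finite index respecting `Γ`. -/
structure Filtration {A : Type} (M : Model A) (Γ : Set (Form A)) : Type where
  equiv : Setoid M.frame.World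
  finite_index : Finite (Quotient equiv)
  respects : ∀ x y, equiv x y → M.inducedSetoid Γ x y
  rel : A → Quotient equiv → Quotient equiv → Prop
  val : ℕ → Set (Quotient equiv)
  val_iff : ∀ p : ℕ, Form.var p ∈ Γ →
    ∀ x : M.frame.World, Quotient.mk equiv x ∈ val p ↔ x ∈ M.val p
  min_le : ∀ e a b, M.minRel equiv e a b → rel e a b
  le_max : ∀ e a b, rel e a b → M.maxRel Γ equiv e a b

namespace Filtration

variable {A : Type} {M : Model A} {Γ : Set (Form A)}

/-- The underlying frame of a filtration. -/
def frame (f : Filtration M Γ) : Frame A where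
  World := Quotient f.equiv
  nonempty := M.frame.nonempty.map (Quotient.mk f.equiv)
  rel := f.rel

/-- A filtration is strict if its equivalence relation is the one induced by `Γ`. -/
def IsStrict (f : Filtration M Γ) : Prop := f.equiv = M.inducedSetoid Γ

end Filtration

/-- A class of frames admits strict filtration if for every finite `Sub`-closed set `Γ` of formulas,
every model on a frame of the class has a strict `Γ`-filtration on a frame of the class. -/
def AdmitsStrictFiltration {A : Type} (C : Set (Frame A)) : Prop :=
  ∀ Γ : Set (Form A), Γ.Finite → SubClosed Γ →
    ∀ M : Model A, M.frame ∈ C → ∃ f : Filtration M Γ, f.IsStrict ∧ f.frame ∈ C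

/-! ### Fusions and PDL-like expansions -/

/-- The fusion of a family of logics, over the disjoint union of their alphabets: the smallest
normal logic containing all of them. -/
def fusion {I : Type} {A : I → Type} (L : ∀ i, ModalLogic (A i)) : ModalLogic (Σ i, A i) :=
  ModalLogic.generate (⋃ i, Form.rename (Sigma.mk i) '' (L i).thms)

/-- The alphabet `A♯`: the symbols of `A` together with new symbols `e ∘ c`, `e ∪ c` and `e⁺`
for all `e, c` in `A`. -/
inductive Sharp (A : Type) : Type where
  | base : A → Sharp A
  | comp : A → A → Sharp A
  | union : A → A → Sharp A
  | plus : A → Sharp A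

/-- The PDL-like axioms over the alphabet `A♯`. -/
inductive PDLAxiom {A : Type} : Form (Sharp A) → Prop where
  | union (e c : A) : PDLAxiom (.iff (.box (.union e c) (.var 0))
      (.and (.box (.base e) (.var 0)) (.box (.base c) (.var 0))))
  | comp (e c : A) : PDLAxiom (.iff (.box (.comp e c) (.var 0))
      (.box (.base e) (.box (.base c) (.var 0))))
  | plus_one (e : A) : PDLAxiom (.imp (.box (.plus e) (.var 0)) (.box (.base e) (.var 0)))
  | plus_step (e : A) : PDLAxiom (.imp (.box (.plus e) (.var 0))
      (.box (.base e) (.box (.plus e) (.var 0))))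
  | plus_ind (e : A) : PDLAxiom (.imp (.box (.plus e) (.imp (.var 0) (.box (.base e) (.var 0))))
      (.imp (.box (.base e) (.var 0)) (.box (.plus e) (.var 0))))

/-- The logic `L♯`: the smallest normal logic over `A♯` containing `L` and the PDL-like axioms. -/
def ModalLogic.sharp {A : Type} (L : ModalLogic A) : ModalLogic (Sharp A) :=
  ModalLogic.generate (Form.rename Sharp.base '' L.thms ∪ {φ | PDLAxiom φ})

/-- The iterated alphabets: `A^(0) = A` and `A^(n+1) = (A^(n))♯`. -/
def SharpIter (A : Type) : ℕ → Type
  | 0 => A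
  | n + 1 => Sharp (SharpIter A n)

/-- The iterated expansions: `L^(0) = L` and `L^(n+1) = (L^(n))♯`. -/
def ModalLogic.sharpIter {A : Type} (L : ModalLogic A) : (n : ℕ) → ModalLogic (SharpIter A n)
  | 0 => L
  | n + 1 => (L.sharpIter n).sharp

end ModalPDL

/-!
Let `Λ` be the iterated expansion and take a formula outside `Λ`; it fails in the canonical model
of `Λ`, which we filter. Two facts make this work.

* *The reducts of the canonical frame are frames of the `L i`.* A boxed formula whose modality is
  foreign to `L i` behaves like a letter, and since the alphabets are countable there is a
  *bijective* translation of the formulas of `L i` onto all formulas of `Λ`. It identifies the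
  reduct of the canonical frame of `Λ` with a generated subframe of the canonical frame of `L i`,
  and canonicity of `L i` applies.
* *Definable filtrations survive the PDL-like expansion.* Suppose every equivalence class of a
  filtration is defined by a formula. Interpret the new symbols on the quotient by composition,
  union and transitive closure. For the induction scheme this is enough: the set of points whose
  class is reachable by the transitive closure is defined by some `ψ`, so `□⁺ψ` follows from the
  scheme, and hence `R⁺` of the model is included in the transitive closure on the quotient.

For the fusion itself the classes of a strict filtration are definable, and the strict filtrations
of the `L i` for one common `Γ` live on the same quotient, so their relations can be put together.
-/

namespace ModalPDL

/-! ### Formulas and translations between alphabets -/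

namespace Form

variable {A B C : Type}

theorem mem_subformulas_self (φ : Form A) : φ ∈ φ.subformulas := by
  cases φ <;> simp [subformulas]

theorem subformulas_finite (φ : Form A) : φ.subformulas.Finite := by
  induction φ with
  | bot => exact Set.finite_singleton _
  | var p => exact Set.finite_singleton _
  | imp φ ψ ihφ ihψ => exact (Set.finite_singleton _).union (ihφ.union ihψ)
  | box e φ ih => exact (Set.finite_singleton _).union ih

theorem subClosed_subformulas (φ : Form A) : SubClosed φ.subformulas := by
  induction φ with
  | bot => rintro _ rfl; exact subset_rfl
  | var p => rintro _ rfl; exact subset_rfl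
  | imp φ ψ ihφ ihψ =>
    rintro χ (rfl | hχ | hχ)
    · exact subset_rfl
    · exact (ihφ χ hχ).trans (Set.subset_union_left.trans Set.subset_union_right)
    · exact (ihψ χ hχ).trans (Set.subset_union_right.trans Set.subset_union_right)
  | box e φ ih =>
    rintro χ (rfl | hχ)
    · exact subset_rfl
    · exact (ih χ hχ).trans Set.subset_union_right

theorem rename_id (φ : Form A) : φ.rename id = φ := by
  induction φ with
  | bot => rfl
  | var p => rfl
  | imp φ ψ ihφ ihψ => simp only [rename, ihφ, ihψ]
  | box e φ ih => simp only [rename, ih, id]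

theorem rename_rename (f : A → B) (g : B → C) (φ : Form A) :
    (φ.rename f).rename g = φ.rename (g ∘ f) := by
  induction φ with
  | bot => rfl
  | var p => rfl
  | imp φ ψ ihφ ihψ => simp only [rename, ihφ, ihψ]
  | box e φ ih => simp only [rename, ih, Function.comp]

/-- A Gödel numbering of formulas, built from a numbering of the modalities. -/
def code (c : A → ℕ) : Form A → ℕ
  | bot => Nat.pair 0 0
  | var p => Nat.pair 1 p
  | imp φ ψ => Nat.pair 2 (Nat.pair (code c φ) (code c ψ))
  | box e φ => Nat.pair 3 (Nat.pair (c e) (code c φ))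

theorem code_injective {c : A → ℕ} (hc : Function.Injective c) : Function.Injective (code c) := by
  intro φ ψ h
  induction φ generalizing ψ <;> cases ψ <;>
    grind [code, Nat.pair_eq_pair, Function.Injective]

instance [Countable A] : Countable (Form A) :=
  let ⟨_, hc⟩ := exists_injective_nat A
  (code_injective hc).countable

/-- The formula obtained by renaming the modalities along `f` and then substituting `g p` for the
letter `p`. -/
def translate (f : A → B) (g : ℕ → Form B) (φ : Form A) : Form B := (φ.rename f).subst g

/-- The formulas over `B` that act as letters when only the modalities in the range of `f` are
regarded as modalities: the letters and the formulas boxed by any other modality. -/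
def IsAtom (f : A → B) : Form B → Prop
  | bot => False
  | var _ => True
  | imp _ _ => False
  | box b _ => b ∉ Set.range f

theorem translate_mem_subformulas (f : A → B) (g : ℕ → Form B) {φ χ : Form A}
    (h : χ ∈ φ.subformulas) : χ.translate f g ∈ (φ.translate f g).subformulas := by
  induction φ with
  | bot => obtain rfl := h; exact mem_subformulas_self _
  | var p => obtain rfl := h; exact mem_subformulas_self _
  | imp φ ψ ihφ ihψ =>
    rcases h with rfl | h | h
    · exact mem_subformulas_self _
    · exact Or.inr (Or.inl (ihφ h))
    · exact Or.inr (Or.inr (ihψ h))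
  | box e φ ih =>
    rcases h with rfl | h
    · exact mem_subformulas_self _
    · exact Or.inr (ih h)

theorem translate_surjective {f : A → B} {g : ℕ → Form B}
    (hg : ∀ φ : Form B, φ.IsAtom f → φ ∈ Set.range g) :
    Function.Surjective (translate f g) := by
  have of_isAtom {φ : Form B} (hφ : φ.IsAtom f) : ∃ ψ, translate f g ψ = φ :=
    let ⟨p, hp⟩ := hg φ hφ
    ⟨var p, hp⟩
  intro φ
  induction φ with
  | bot => exact ⟨bot, rfl⟩
  | var p => exact of_isAtom trivial
  | imp φ ψ ihφ ihψ =>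
    obtain ⟨φ, rfl⟩ := ihφ
    obtain ⟨ψ, rfl⟩ := ihψ
    exact ⟨imp φ ψ, rfl⟩
  | box b φ ih =>
    by_cases hb : b ∈ Set.range f
    · obtain ⟨a, rfl⟩ := hb
      obtain ⟨φ, rfl⟩ := ih
      exact ⟨box a φ, rfl⟩
    · exact of_isAtom hb

theorem isAtom_translate_iff {f : A → B} {g : ℕ → Form B} (hatom : ∀ p, (g p).IsAtom f)
    {φ : Form A} : (φ.translate f g).IsAtom f ↔ ∃ p, φ = var p := by
  cases φ with
  | var p => exact iff_of_true (hatom p) ⟨p, rfl⟩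
  | bot | imp | box => simp [translate, rename, subst, IsAtom]

theorem translate_injective {f : A → B} {g : ℕ → Form B} (hf : Function.Injective f)
    (hg : Function.Injective g) (hatom : ∀ p, (g p).IsAtom f) :
    Function.Injective (translate f g) := by
  have isVar_iff {φ ψ : Form A} (h : φ.translate f g = ψ.translate f g) :
      (∃ p, φ = var p) ↔ ∃ p, ψ = var p := by
    rw [← isAtom_translate_iff hatom, h, isAtom_translate_iff hatom]
  intro φ ψ h
  induction φ generalizing ψ with
  | var p =>
    obtain ⟨q, rfl⟩ := (isVar_iff h).mp ⟨p, rfl⟩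
    exact congrArg var (hg h)
  | bot =>
    cases ψ with
    | bot => rfl
    | var q => simpa using isVar_iff h
    | imp | box => cases h
  | imp φ₁ φ₂ ih₁ ih₂ =>
    cases ψ with
    | imp ψ₁ ψ₂ =>
      obtain ⟨h₁, h₂⟩ := imp.inj h
      rw [ih₁ h₁, ih₂ h₂]
    | var q => simpa using isVar_iff h
    | bot | box => cases h
  | box e φ ih =>
    cases ψ with
    | box c ψ =>
      obtain ⟨h₁, h₂⟩ := box.inj h
      rw [hf h₁, ih h₂]
    | var q => simpa using isVar_iff h
    | bot | imp => cases h

theorem exists_translate_bijective [Countable B] {f : A → B} (hf : Function.Injective f) :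
    ∃ g : ℕ → Form B, Function.Bijective (translate f g) := by
  have : Infinite {φ : Form B // φ.IsAtom f} :=
    Infinite.of_injective (fun p : ℕ => ⟨var p, trivial⟩) fun _ _ h =>
      var.inj (congrArg Subtype.val h)
  obtain ⟨E⟩ := nonempty_equiv_of_countable (α := ℕ) (β := {φ : Form B // φ.IsAtom f})
  exact ⟨fun p => E p,
    translate_injective hf (Subtype.val_injective.comp E.injective) fun p => (E p).2,
    translate_surjective fun φ hφ => ⟨E.symm ⟨φ, hφ⟩, congrArg _ (E.apply_symm_apply _)⟩⟩

end Form

section SubClosed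

variable {A B : Type}

theorem SubClosed.preimage_translate {Γ : Set (Form B)} (hΓ : SubClosed Γ) (f : A → B)
    (g : ℕ → Form B) : SubClosed (Form.translate f g ⁻¹' Γ) :=
  fun φ hφ _ hχ => hΓ (φ.translate f g) hφ (Form.translate_mem_subformulas f g hχ)

theorem exists_finite_subClosed_superset {Γ : Set (Form A)} (hΓ : Γ.Finite) :
    ∃ Δ : Set (Form A), Δ.Finite ∧ SubClosed Δ ∧ Γ ⊆ Δ := by
  refine ⟨⋃ φ ∈ Γ, φ.subformulas, hΓ.biUnion fun φ _ => φ.subformulas_finite, ?_,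
    fun φ hφ => Set.mem_biUnion hφ φ.mem_subformulas_self⟩
  intro χ hχ
  obtain ⟨φ, hφ, hχ⟩ := Set.mem_iUnion₂.1 hχ
  exact (φ.subClosed_subformulas χ hχ).trans (Set.subset_biUnion_of_mem (u := Form.subformulas) hφ)

end SubClosed

/-! ### Truth and validity -/

section Semantics

variable {A B C : Type}

theorem Model.sat_and (M : Model A) (x : M.frame.World) (φ ψ : Form A) :
    M.Sat x (.and φ ψ) ↔ M.Sat x φ ∧ M.Sat x ψ := by
  simp only [Form.and, Form.neg, Model.Sat]
  tauto

theorem Model.sat_iff (M : Model A) (x : M.frame.World) (φ ψ : Form A) :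
    M.Sat x (.iff φ ψ) ↔ (M.Sat x φ ↔ M.Sat x ψ) := by
  rw [Form.iff, Model.sat_and]
  exact iff_iff_implies_and_implies.symm

theorem Model.sat_subst (M : Model A) (σ : ℕ → Form A) (φ : Form A) (x : M.frame.World) :
    M.Sat x (φ.subst σ) ↔ (Model.mk M.frame fun p => {y | M.Sat y (σ p)}).Sat x φ := by
  induction φ generalizing x with
  | bot => exact Iff.rfl
  | var p => exact Iff.rfl
  | imp φ ψ ihφ ihψ => exact imp_congr (ihφ x) (ihψ x)
  | box e φ ih => exact forall₂_congr fun y _ => ih y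

/-- The frame over `A` whose relation for `a` is the one of `f a` in a given frame over `B`. -/
def Frame.reduct (f : A → B) (F : Frame B) : Frame A where
  World := F.World
  nonempty := F.nonempty
  rel a := F.rel (f a)

theorem Model.sat_rename (f : A → B) (M : Model B) (φ : Form A) (x : M.frame.World) :
    M.Sat x (φ.rename f) ↔ (Model.mk (M.frame.reduct f) M.val).Sat x φ := by
  induction φ generalizing x with
  | bot => exact Iff.rfl
  | var p => exact Iff.rfl
  | imp φ ψ ihφ ihψ => exact imp_congr (ihφ x) (ihψ x)
  | box e φ ih => exact forall₂_congr fun y _ => ih y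

theorem Frame.valid_rename (f : A → B) (F : Frame B) (φ : Form A) :
    F.Valid (φ.rename f) ↔ (F.reduct f).Valid φ :=
  forall₂_congr fun V x => Model.sat_rename f ⟨F, V⟩ φ x

/-- The model on the reduct of `M` along `f` in which the letter `p` is interpreted as the formula
`g p` of `M`, so that it evaluates `φ` as `M` evaluates `φ.translate f g`. -/
def Model.pullback (f : A → B) (g : ℕ → Form B) (M : Model B) : Model A where
  frame := M.frame.reduct f
  val p := {x | M.Sat x (g p)}

theorem Model.sat_pullback (f : A → B) (g : ℕ → Form B) (M : Model B) (φ : Form A)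
    (x : M.frame.World) : (M.pullback f g).Sat x φ ↔ M.Sat x (φ.translate f g) :=
  ((M.sat_subst g (φ.rename f) x).trans
    (Model.sat_rename f ⟨M.frame, fun p => {x | M.Sat x (g p)}⟩ φ x)).symm

/-- Bounded morphisms of frames, also known as p-morphisms. -/
structure Frame.IsBoundedMorphism {F G : Frame A} (ι : F.World → G.World) : Prop where
  forth : ∀ e x y, F.rel e x y → G.rel e (ι x) (ι y)
  back : ∀ e x y, G.rel e (ι x) y → ∃ z, ι z = y ∧ F.rel e x z

theorem Frame.IsBoundedMorphism.sat_iff {F G : Frame A} {ι : F.World → G.World}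
    (hι : IsBoundedMorphism ι) (V : ℕ → Set G.World) (φ : Form A) (x : F.World) :
    (Model.mk F fun p => ι ⁻¹' V p).Sat x φ ↔ (Model.mk G V).Sat (ι x) φ := by
  induction φ generalizing x with
  | bot => exact Iff.rfl
  | var p => exact Iff.rfl
  | imp φ ψ ihφ ihψ => exact imp_congr (ihφ x) (ihψ x)
  | box e φ ih =>
    refine ⟨fun h y hxy => ?_, fun h y hxy => (ih y).2 (h (ι y) (hι.forth e x y hxy))⟩
    obtain ⟨z, rfl, hxz⟩ := hι.back e x y hxy
    exact (ih z).1 (h z hxz)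

theorem Frame.IsBoundedMorphism.valid_of_injective {F G : Frame A} {ι : F.World → G.World}
    (hι : IsBoundedMorphism ι) (hinj : Function.Injective ι) {φ : Form A} (hφ : G.Valid φ) :
    F.Valid φ := by
  intro V x
  have preimage_image : (fun p => ι ⁻¹' (ι '' V p)) = V :=
    funext fun p => Set.preimage_image_eq (V p) hinj
  rw [← preimage_image]
  exact (hι.sat_iff (fun p => ι '' V p) φ x).2 (hφ _ _)

/-- The logic of a frame. -/
def Frame.logic (F : Frame A) : ModalLogic A where
  thms := {φ | F.Valid φ}
  taut _ h V x := h ((Model.mk F V).Sat x) id fun _ _ => Iff.rfl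
  axK _ _ _ h₁ h₂ y hy := h₁ y hy (h₂ y hy)
  mp _ _ h₁ h₂ V x := h₁ V x (h₂ V x)
  subst σ φ h V x := (Model.sat_subst ⟨F, V⟩ σ φ x).2 (h _ x)
  nec _ _ h V _ y _ := h V y

namespace ModalLogic

theorem mem_frames_generate {S : Set (Form A)} {F : Frame A} :
    F ∈ (generate S).frames ↔ ∀ φ ∈ S, F.Valid φ :=
  ⟨fun h φ hφ => h φ (subset_generate S hφ), fun h _ hφ => generate_subset (L := F.logic) h hφ⟩

/-- The class of all models in which every formula of `L` is true at every point. -/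
def models (L : ModalLogic A) : Set (Model A) :=
  {M | ∀ φ ∈ L.thms, ∀ x, M.Sat x φ}

/-- `Λ` contains `L` when the modalities of `L` are read along `f`. -/
def Extends (Λ : ModalLogic B) (f : A → B) (L : ModalLogic A) : Prop :=
  ∀ φ ∈ L.thms, φ.rename f ∈ Λ.thms

theorem extends_id (L : ModalLogic A) : L.Extends id L :=
  fun φ hφ => φ.rename_id.symm ▸ hφ

theorem Extends.trans {N : ModalLogic C} {Λ : ModalLogic B} {L : ModalLogic A} {g : B → C}
    {f : A → B} (hN : N.Extends g Λ) (hΛ : Λ.Extends f L) : N.Extends (g ∘ f) L :=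
  fun φ hφ => φ.rename_rename f g ▸ hN _ (hΛ φ hφ)

theorem Extends.translate_mem {Λ : ModalLogic B} {f : A → B} {L : ModalLogic A}
    (h : Λ.Extends f L) (g : ℕ → Form B) {φ : Form A} (hφ : φ ∈ L.thms) :
    φ.translate f g ∈ Λ.thms :=
  Λ.subst g _ (h φ hφ)

theorem Extends.pullback_mem_models {Λ : ModalLogic B} {f : A → B} {L : ModalLogic A}
    (h : Λ.Extends f L) {M : Model B} (hM : M ∈ Λ.models) (g : ℕ → Form B) :
    M.pullback f g ∈ L.models :=
  fun φ hφ x => (M.sat_pullback f g φ x).2 (hM _ (h.translate_mem g hφ) x)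

end ModalLogic

theorem fusion_extends {I : Type} {A : I → Type} (L : ∀ i, ModalLogic (A i)) (i : I) :
    (fusion L).Extends (Sigma.mk i) (L i) :=
  fun φ hφ => ModalLogic.subset_generate _ (Set.mem_iUnion.2 ⟨i, φ, hφ, rfl⟩)

theorem mem_frames_fusion {I : Type} {A : I → Type} {L : ∀ i, ModalLogic (A i)}
    {F : Frame (Σ i, A i)} :
    F ∈ (fusion L).frames ↔ ∀ i, F.reduct (Sigma.mk i) ∈ (L i).frames := by
  refine ⟨fun hF i φ hφ => (F.valid_rename _ φ).1 (hF _ (fusion_extends L i φ hφ)), fun hF => ?_⟩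
  refine ModalLogic.mem_frames_generate.2 fun φ hφ => ?_
  obtain ⟨i, ψ, hψ, rfl⟩ := Set.mem_iUnion.1 hφ
  exact (F.valid_rename _ ψ).2 (hF i ψ hψ)

end Semantics

/-! ### Canonical models -/

namespace ModalLogic

variable {A B : Type}

theorem box_imp_mem (L : ModalLogic A) (e : A) (φ ψ : Form A) :
    Form.imp (.box e (.imp φ ψ)) (.imp (.box e φ) (.box e ψ)) ∈ L.thms :=
  L.subst (fun p => if p = 0 then φ else ψ) _ (L.axK e)

/-- The `L`-theories: the sets of formulas that contain `L` and are closed under modus ponens,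
consistent or not. -/
structure IsTheory (L : ModalLogic A) (T : Set (Form A)) : Prop where
  contains : L.thms ⊆ T
  mp : ∀ φ ψ : Form A, Form.imp φ ψ ∈ T → φ ∈ T → ψ ∈ T

theorem isTheory_thms (L : ModalLogic A) : L.IsTheory L.thms := ⟨subset_rfl, L.mp⟩

theorem CanonicalWorld.isTheory {L : ModalLogic A} (x : L.CanonicalWorld) : L.IsTheory x.theory :=
  ⟨x.contains, x.mp⟩

section IsTheory

variable {L : ModalLogic A} {T : Set (Form A)}

theorem IsTheory.taut_mem (hT : L.IsTheory T) {φ : Form A} (hφ : φ.IsTautology) : φ ∈ T :=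
  hT.contains (L.taut φ hφ)

theorem IsTheory.imp_preimage (hT : L.IsTheory T) (χ : Form A) :
    L.IsTheory {ψ | Form.imp χ ψ ∈ T} where
  contains ψ hψ := hT.mp ψ _
    (hT.taut_mem fun v _ himp => by simp only [himp]; tauto) (hT.contains hψ)
  mp φ ψ hφψ hφ :=
    have hS : Form.imp (.imp χ (.imp φ ψ)) (.imp (.imp χ φ) (.imp χ ψ)) ∈ T :=
      hT.taut_mem fun v _ himp => by simp only [himp]; tauto
    hT.mp _ _ (hT.mp _ _ hS hφψ) hφ

theorem IsTheory.box_preimage (hT : L.IsTheory T) (e : A) :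
    L.IsTheory {ψ | Form.box e ψ ∈ T} where
  contains ψ hψ := hT.contains (L.nec e ψ hψ)
  mp φ ψ hφψ hφ := hT.mp _ _ (hT.mp _ _ (hT.contains (L.box_imp_mem e φ ψ)) hφψ) hφ

theorem IsTheory.sUnion {c : Set (Set (Form A))} (hc : ∀ T ∈ c, L.IsTheory T)
    (hchain : IsChain (· ⊆ ·) c) (hne : c.Nonempty) : L.IsTheory (⋃₀ c) where
  contains :=
    let ⟨T, hT⟩ := hne
    (hc T hT).contains.trans (Set.subset_sUnion_of_mem hT)
  mp := by
    rintro φ ψ ⟨S, hS, hφψ⟩ ⟨T, hT, hφ⟩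
    rcases hchain.total hS hT with hST | hTS
    · exact ⟨T, hT, (hc T hT).mp φ ψ (hST hφψ) hφ⟩
    · exact ⟨S, hS, (hc S hS).mp φ ψ hφψ (hTS hφ)⟩

theorem IsTheory.exists_maximal_notMem (hT : L.IsTheory T) {φ : Form A} (hφ : φ ∉ T) :
    ∃ S, T ⊆ S ∧ Maximal (fun S => L.IsTheory S ∧ φ ∉ S) S := by
  refine zorn_subset_nonempty {S | L.IsTheory S ∧ φ ∉ S} (fun c hc hchain hne => ?_) T ⟨hT, hφ⟩
  refine ⟨⋃₀ c, ⟨.sUnion (fun S hS => (hc hS).1) hchain hne, ?_⟩,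
    fun S hS => Set.subset_sUnion_of_mem hS⟩
  rintro ⟨S, hS, hφS⟩
  exact (hc hS).2 hφS

theorem imp_mem_of_maximal_notMem {φ χ : Form A}
    (hT : Maximal (fun S => L.IsTheory S ∧ φ ∉ S) T) (hχ : χ ∉ T) : Form.imp χ φ ∈ T := by
  have hTχ := hT.prop.1.imp_preimage χ
  by_contra hφ
  have hsub : T ⊆ {ψ | Form.imp χ ψ ∈ T} := fun ψ hψ =>
    hT.prop.1.mp ψ _ (hT.prop.1.taut_mem fun v _ himp => by simp only [himp]; tauto) hψ
  exact hχ (hT.le_of_ge ⟨hTχ, hφ⟩ hsub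
    (hT.prop.1.taut_mem fun v _ himp => by simp only [himp]; tauto))

theorem IsTheory.exists_canonicalWorld (hT : L.IsTheory T) {φ : Form A} (hφ : φ ∉ T) :
    ∃ x : L.CanonicalWorld, T ⊆ x.theory ∧ φ ∉ x.theory := by
  obtain ⟨S, hTS, hmax⟩ := hT.exists_maximal_notMem hφ
  obtain ⟨hS, hφS⟩ := hmax.prop
  refine ⟨⟨S, hS.contains, hS.mp, fun χ hχ => ?_, fun χ => ?_⟩, hTS, hφS⟩
  · have hexplosion : Form.imp χ (.imp χ.neg φ) ∈ S :=
      hS.taut_mem fun v _ himp => by simp only [himp, Form.neg]; tauto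
    exact hφS (hS.mp _ _ (hS.mp _ _ hexplosion hχ.1) hχ.2)
  · by_contra! hχ
    have hcases : Form.imp (.imp χ φ) (.imp (.imp χ.neg φ) φ) ∈ S :=
      hS.taut_mem fun v _ himp => by simp only [himp, Form.neg]; tauto
    exact hφS (hS.mp _ _ (hS.mp _ _ hcases (imp_mem_of_maximal_notMem hmax hχ.1))
      (imp_mem_of_maximal_notMem hmax hχ.2))

end IsTheory

theorem CanonicalWorld.ext {L : ModalLogic A} {x y : L.CanonicalWorld}
    (h : x.theory = y.theory) : x = y := by
  cases x
  cases y
  cases h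
  rfl

theorem CanonicalWorld.bot_notMem {L : ModalLogic A} (x : L.CanonicalWorld) :
    Form.bot ∉ x.theory := fun h =>
  x.consistent .bot ⟨h, x.isTheory.taut_mem fun v _ himp => by simp only [himp, Form.neg]; tauto⟩

theorem CanonicalWorld.imp_mem {L : ModalLogic A} (x : L.CanonicalWorld) (φ ψ : Form A) :
    Form.imp φ ψ ∈ x.theory ↔ (φ ∈ x.theory → ψ ∈ x.theory) := by
  refine ⟨x.mp φ ψ, fun h => ?_⟩
  rcases x.complete φ with hφ | hφ
  · exact x.mp ψ _ (x.isTheory.taut_mem fun v _ himp => by simp only [himp]; tauto) (h hφ)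
  · have hexplosion : Form.imp φ.neg (.imp φ ψ) ∈ x.theory :=
      x.isTheory.taut_mem fun v _ himp => by simp only [himp, Form.neg]; tauto
    exact x.mp _ _ hexplosion hφ

/-- The canonical model: the canonical frame, where a letter is true at the points containing
it. -/
def canonicalModel (L : ModalLogic A) (h : Nonempty L.CanonicalWorld) : Model A where
  frame := L.canonicalFrame h
  val p := {x : L.CanonicalWorld | Form.var p ∈ x.theory}

theorem sat_canonicalModel (L : ModalLogic A) (h : Nonempty L.CanonicalWorld) (φ : Form A)
    (x : L.CanonicalWorld) : (L.canonicalModel h).Sat x φ ↔ φ ∈ x.theory := by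
  induction φ generalizing x with
  | bot => exact ⟨False.elim, x.bot_notMem⟩
  | var p => exact Iff.rfl
  | imp φ ψ ihφ ihψ => exact (imp_congr (ihφ x) (ihψ x)).trans (x.imp_mem φ ψ).symm
  | box e φ ih =>
    refine ⟨fun hx => ?_, fun hx y hxy => (ih y).2 (hxy φ hx)⟩
    by_contra hbox
    obtain ⟨y, hxy, hφ⟩ := (x.isTheory.box_preimage e).exists_canonicalWorld hbox
    exact hφ ((ih y).1 (hx y hxy))

theorem canonicalModel_mem_models (L : ModalLogic A) (h : Nonempty L.CanonicalWorld) :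
    L.canonicalModel h ∈ L.models :=
  fun φ hφ x => (L.sat_canonicalModel h φ x).2 (CanonicalWorld.contains x hφ)

section Comap

variable {L : ModalLogic A} {Λ : ModalLogic B} {f : A → B}

/-- The formulas over `A` whose translations belong to a given point of the canonical frame of an
extension `Λ` of `L` form a point of the canonical frame of `L`. -/
def CanonicalWorld.comap (hΛ : Λ.Extends f L) (g : ℕ → Form B) (x : Λ.CanonicalWorld) :
    L.CanonicalWorld where
  theory := Form.translate f g ⁻¹' x.theory
  contains _ hφ := x.contains (hΛ.translate_mem g hφ)
  mp φ ψ := x.mp (φ.translate f g) (ψ.translate f g)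
  consistent φ := x.consistent (φ.translate f g)
  complete φ := x.complete (φ.translate f g)

theorem CanonicalWorld.comap_injective (hΛ : Λ.Extends f L) {g : ℕ → Form B}
    (hg : Function.Surjective (Form.translate f g)) : Function.Injective (comap hΛ g) :=
  fun _ _ h => CanonicalWorld.ext (hg.preimage_injective (congrArg theory h))

theorem CanonicalWorld.exists_comap_eq (hΛ : Λ.Extends f L) {g : ℕ → Form B}
    (hg : Function.Bijective (Form.translate f g)) (y : L.CanonicalWorld)
    (hy : Λ.thms ⊆ Form.translate f g '' y.theory) : ∃ z : Λ.CanonicalWorld, z.comap hΛ g = y := by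
  have mem (φ : Form A) : φ.translate f g ∈ Form.translate f g '' y.theory ↔ φ ∈ y.theory :=
    hg.1.mem_set_image
  refine ⟨⟨Form.translate f g '' y.theory, hy, ?_, ?_, ?_⟩,
    CanonicalWorld.ext (Set.preimage_image_eq _ hg.1)⟩
  · refine hg.2.forall₂.2 fun φ ψ hφψ hφ => (mem ψ).2 (y.mp φ ψ ((mem (.imp φ ψ)).1 hφψ) ?_)
    exact (mem φ).1 hφ
  · exact hg.2.forall.2 fun φ hφ => y.consistent φ ⟨(mem φ).1 hφ.1, (mem φ.neg).1 hφ.2⟩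
  · exact hg.2.forall.2 fun φ => (y.complete φ).imp (mem φ).2 (mem φ.neg).2

theorem CanonicalWorld.isBoundedMorphism_comap (hΛ : Λ.Extends f L) {g : ℕ → Form B}
    (hg : Function.Bijective (Form.translate f g)) (h : Nonempty Λ.CanonicalWorld)
    (h' : Nonempty L.CanonicalWorld) :
    Frame.IsBoundedMorphism (F := (Λ.canonicalFrame h).reduct f) (G := L.canonicalFrame h')
      (comap hΛ g) where
  forth _ _ _ hxy φ hφ := hxy (φ.translate f g) hφ
  back e x y hxy := by
    have mem_of_box_mem : ∀ φ : Form B, Form.box (f e) φ ∈ CanonicalWorld.theory x →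
        φ ∈ Form.translate f g '' y.theory :=
      hg.2.forall.2 fun φ hφ => ⟨φ, hxy φ hφ, rfl⟩
    obtain ⟨z, rfl⟩ := CanonicalWorld.exists_comap_eq hΛ hg y fun φ hφ =>
      mem_of_box_mem φ (CanonicalWorld.contains x (Λ.nec (f e) φ hφ))
    refine ⟨z, rfl, fun φ hφ => ?_⟩
    obtain ⟨ψ, hψ, rfl⟩ := mem_of_box_mem φ hφ
    exact hψ

theorem IsCanonical.reduct_canonicalFrame_mem_frames [Countable B] (hL : L.IsCanonical)
    (hΛ : Λ.Extends f L) (hf : Function.Injective f) (h : Nonempty Λ.CanonicalWorld) :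
    (Λ.canonicalFrame h).reduct f ∈ L.frames := by
  obtain ⟨g, hg⟩ := Form.exists_translate_bijective hf
  have h' : Nonempty L.CanonicalWorld := h.map (CanonicalWorld.comap hΛ g)
  exact fun φ hφ => (CanonicalWorld.isBoundedMorphism_comap hΛ hg h h').valid_of_injective
    (CanonicalWorld.comap_injective hΛ hg.2) (hL h' φ hφ)

end Comap

end ModalLogic

/-! ### Definable sets of points -/

namespace Model

variable {A B : Type} {M : Model A}

/-- A set of points of a model is definable if it is the truth set of some formula. -/
def IsDefinable (M : Model A) (S : Set M.frame.World) : Prop :=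
  ∃ ψ : Form A, ∀ x, M.Sat x ψ ↔ x ∈ S

theorem IsDefinable.compl {S : Set M.frame.World} (hS : M.IsDefinable S) : M.IsDefinable Sᶜ :=
  let ⟨ψ, hψ⟩ := hS
  ⟨ψ.neg, fun x => not_congr (hψ x)⟩

theorem IsDefinable.union {S T : Set M.frame.World} (hS : M.IsDefinable S)
    (hT : M.IsDefinable T) : M.IsDefinable (S ∪ T) := by
  obtain ⟨ψ, hψ⟩ := hS
  obtain ⟨χ, hχ⟩ := hT
  refine ⟨.imp ψ.neg χ, fun x => ?_⟩
  rw [Set.mem_union, ← hψ, ← hχ]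
  exact or_iff_not_imp_left.symm

theorem isDefinable_biUnion {ι : Type*} {s : Set ι} (hs : s.Finite) {S : ι → Set M.frame.World}
    (hS : ∀ i ∈ s, M.IsDefinable (S i)) : M.IsDefinable (⋃ i ∈ s, S i) := by
  induction s, hs using Set.Finite.induction_on with
  | empty => exact ⟨.bot, fun x => by simp [Model.Sat]⟩
  | insert _ _ ih =>
    rw [Set.biUnion_insert]
    exact (hS _ (Set.mem_insert _ _)).union (ih fun i hi => hS i (Set.mem_insert_of_mem _ hi))

theorem isDefinable_biInter {ι : Type*} {s : Set ι} (hs : s.Finite) {S : ι → Set M.frame.World}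
    (hS : ∀ i ∈ s, M.IsDefinable (S i)) : M.IsDefinable (⋂ i ∈ s, S i) := by
  simpa only [Set.compl_iUnion₂, compl_compl] using
    (isDefinable_biUnion hs fun i hi => (hS i hi).compl).compl

theorem IsDefinable.of_pullback {M : Model B} {f : A → B} {g : ℕ → Form B}
    {S : Set M.frame.World} (hS : (M.pullback f g).IsDefinable S) : M.IsDefinable S :=
  let ⟨ψ, hψ⟩ := hS
  ⟨ψ.translate f g, fun x => (M.sat_pullback f g ψ x).symm.trans (hψ x)⟩

theorem isDefinable_inducedSetoid_class {Γ : Set (Form A)} (hΓ : Γ.Finite)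
    (a : Quotient (M.inducedSetoid Γ)) :
    M.IsDefinable (Quotient.mk (M.inducedSetoid Γ) ⁻¹' {a}) := by
  obtain ⟨x, rfl⟩ := Quotient.exists_rep a
  have hclass : Quotient.mk (M.inducedSetoid Γ) ⁻¹' {Quotient.mk _ x} =
      ⋂ φ ∈ Γ, {y | M.Sat y φ ↔ M.Sat x φ} := by
    ext y
    rw [Set.mem_iInter₂]
    exact Quotient.eq
  rw [hclass]
  refine isDefinable_biInter hΓ fun φ _ => ?_
  by_cases hx : M.Sat x φ
  · exact ⟨φ, fun y => (iff_true_right hx).symm⟩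
  · exact ⟨φ.neg, fun y => (iff_false_right hx).symm⟩

end Model

/-! ### Filtrations -/

namespace Model

variable {A B : Type}

theorem inducedSetoid_anti (M : Model A) {Γ Δ : Set (Form A)} (h : Γ ⊆ Δ) :
    M.inducedSetoid Δ ≤ M.inducedSetoid Γ :=
  fun _ _ hxy φ hφ => hxy φ (h hφ)

theorem finite_quotient_inducedSetoid (M : Model A) {Γ : Set (Form A)} (hΓ : Γ.Finite) :
    Finite (Quotient (M.inducedSetoid Γ)) := by
  have := hΓ.to_subtype
  let truths : Quotient (M.inducedSetoid Γ) → Set Γ :=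
    Quotient.lift (fun x => {φ : Γ | M.Sat x φ}) fun x y hxy => Set.ext fun φ => hxy φ φ.2
  refine Finite.of_injective truths ?_
  rintro ⟨x⟩ ⟨y⟩ hxy
  exact Quotient.sound fun φ hφ => Set.ext_iff.1 hxy ⟨φ, hφ⟩

variable {f : A → B} {g : ℕ → Form B} (hg : Function.Surjective (Form.translate f g))
  (M : Model B) (Γ : Set (Form B))

include hg

theorem inducedSetoid_pullback :
    (M.pullback f g).inducedSetoid (Form.translate f g ⁻¹' Γ) = M.inducedSetoid Γ := by
  refine Setoid.ext fun x y => (hg.forall.trans (forall₂_congr fun φ _ => ?_)).symm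
  exact iff_congr (M.sat_pullback f g φ x).symm (M.sat_pullback f g φ y).symm

theorem maxRel_of_maxRel_pullback {s : Setoid M.frame.World} {e : A} {a b : Quotient s}
    (h : (M.pullback f g).maxRel (Form.translate f g ⁻¹' Γ) s e a b) :
    M.maxRel Γ s (f e) a b := fun x y hx hy =>
  hg.forall.2 fun φ hφ hbox => (M.sat_pullback f g φ y).1
    (h x y hx hy φ hφ ((M.sat_pullback f g (.box e φ) x).2 hbox))

end Model

section Filtration

variable {A : Type} {M : Model A} {Γ : Set (Form A)}

/-- The filtration with prescribed equivalence and relations. A letter is true at a class if it is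
true at one of its points, which for the letters in `Γ` means at all of them. -/
def Filtration.ofRel (s : Setoid M.frame.World) (hfin : Finite (Quotient s))
    (hs : s ≤ M.inducedSetoid Γ) (R : A → Quotient s → Quotient s → Prop)
    (hmin : ∀ e a b, M.minRel s e a b → R e a b)
    (hmax : ∀ e a b, R e a b → M.maxRel Γ s e a b) : Filtration M Γ where
  equiv := s
  finite_index := hfin
  respects _ _ := @hs _ _
  rel := R
  val p := Quotient.mk s '' M.val p
  val_iff p hp x :=
    ⟨fun ⟨_, hy, hyx⟩ => (hs (Quotient.exact hyx) (.var p) hp).1 hy, fun hx => ⟨x, hx, rfl⟩⟩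
  min_le := hmin
  le_max := hmax

theorem Filtration.sat_iff (hΓ : SubClosed Γ) (f : Filtration M Γ) {φ : Form A} (hφ : φ ∈ Γ)
    (x : M.frame.World) :
    (Model.mk f.frame f.val).Sat (Quotient.mk f.equiv x) φ ↔ M.Sat x φ := by
  induction φ generalizing x with
  | bot => exact Iff.rfl
  | var p => exact f.val_iff p hφ x
  | imp φ ψ ihφ ihψ =>
    exact imp_congr (ihφ (hΓ _ hφ (Or.inr (Or.inl φ.mem_subformulas_self))) x)
      (ihψ (hΓ _ hφ (Or.inr (Or.inr ψ.mem_subformulas_self))) x)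
  | box e φ ih =>
    have ih := ih (hΓ _ hφ (Or.inr φ.mem_subformulas_self))
    constructor
    · intro h y hxy
      exact (ih y).1 (h _ (f.min_le e _ _ ⟨x, y, rfl, rfl, hxy⟩))
    · intro h b hb
      obtain ⟨y, rfl⟩ := Quotient.exists_rep b
      exact (ih y).2 (f.le_max e _ _ hb x y rfl rfl φ hφ h)

theorem ModalLogic.hasFMP_of_filtration {L : ModalLogic A}
    (hL : ∀ (h : Nonempty L.CanonicalWorld) (Γ : Set (Form A)), Γ.Finite → SubClosed Γ →
      ∃ f : Filtration (L.canonicalModel h) Γ, f.frame ∈ L.frames) : L.HasFMP := by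
  refine ⟨{F | Finite F.World ∧ F ∈ L.frames}, fun F hF => hF.1, ?_⟩
  refine Set.Subset.antisymm (fun φ hφ F hF => hF.2 φ hφ) fun φ hvalid => ?_
  by_contra hφ
  obtain ⟨x, -, hx⟩ := L.isTheory_thms.exists_canonicalWorld hφ
  obtain ⟨f, hf⟩ := hL ⟨x⟩ φ.subformulas φ.subformulas_finite φ.subClosed_subformulas
  have hsat := hvalid f.frame ⟨f.finite_index, hf⟩ f.val (Quotient.mk f.equiv x)
  exact hx ((L.sat_canonicalModel ⟨x⟩ φ x).1
    ((f.sat_iff φ.subClosed_subformulas φ.mem_subformulas_self x).1 hsat))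

/-- A filtration is definable if each of its equivalence classes is a definable set. As the classes
are finite in number, this amounts to the equivalence being induced by a finite set of formulas. -/
def Filtration.IsDefinable (f : Filtration M Γ) : Prop :=
  ∀ a : Quotient f.equiv, M.IsDefinable (Quotient.mk f.equiv ⁻¹' {a})

theorem Filtration.IsDefinable.preimage {f : Filtration M Γ} (hf : f.IsDefinable)
    (Q : Set (Quotient f.equiv)) : M.IsDefinable (Quotient.mk f.equiv ⁻¹' Q) := by
  have := f.finite_index
  rw [← Set.biUnion_preimage_singleton]
  exact Model.isDefinable_biUnion Q.toFinite fun a _ => hf a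

/-- For all finite subformula-closed `Γ`, the models in `𝓜` have definable `Γ`-filtrations whose
frames are in `C`. Unlike strict filtrations, these can be iterated through PDL-like expansions. -/
def AdmitsDefinableFiltration (𝓜 : Set (Model A)) (C : Set (Frame A)) : Prop :=
  ∀ Γ : Set (Form A), Γ.Finite → SubClosed Γ →
    ∀ M ∈ 𝓜, ∃ f : Filtration M Γ, f.IsDefinable ∧ f.frame ∈ C

theorem AdmitsDefinableFiltration.mono {𝓜 𝓝 : Set (Model A)} {C D : Set (Frame A)}
    (h : AdmitsDefinableFiltration 𝓝 C) (h𝓜 : 𝓜 ⊆ 𝓝) (hC : C ⊆ D) :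
    AdmitsDefinableFiltration 𝓜 D := fun Γ hfin hΓ M hM =>
  let ⟨f, hdef, hf⟩ := h Γ hfin hΓ M (h𝓜 hM)
  ⟨f, hdef, hC hf⟩

theorem AdmitsStrictFiltration.exists_rel {C : Set (Frame A)} (hC : AdmitsStrictFiltration C)
    (hM : M.frame ∈ C) (hfin : Γ.Finite) (hΓ : SubClosed Γ) :
    ∃ R : A → Quotient (M.inducedSetoid Γ) → Quotient (M.inducedSetoid Γ) → Prop,
      (∀ e a b, M.minRel _ e a b → R e a b) ∧ (∀ e a b, R e a b → M.maxRel Γ _ e a b) ∧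
        Frame.mk (Quotient (M.inducedSetoid Γ)) (M.frame.nonempty.map (Quotient.mk _)) R ∈ C := by
  obtain ⟨⟨s, _, _, R, _, _, hmin, hmax⟩, hs, hR⟩ := hC Γ hfin hΓ M hM
  obtain rfl : s = M.inducedSetoid Γ := hs
  exact ⟨R, hmin, hmax, hR⟩

theorem AdmitsStrictFiltration.exists_rel_reduct {B : Type} [Countable B] {M : Model B}
    {Γ : Set (Form B)} {C : Set (Frame A)} (hC : AdmitsStrictFiltration C) {f : A → B}
    (hf : Function.Injective f) (hM : M.frame.reduct f ∈ C) (hfin : Γ.Finite) (hΓ : SubClosed Γ) :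
    ∃ R : A → Quotient (M.inducedSetoid Γ) → Quotient (M.inducedSetoid Γ) → Prop,
      (∀ e a b, M.minRel _ (f e) a b → R e a b) ∧
        (∀ e a b, R e a b → M.maxRel Γ _ (f e) a b) ∧
        Frame.mk (Quotient (M.inducedSetoid Γ)) (M.frame.nonempty.map (Quotient.mk _)) R ∈ C := by
  obtain ⟨g, hg⟩ := Form.exists_translate_bijective hf
  have h := hC.exists_rel (M := M.pullback f g) hM (hfin.preimage hg.1.injOn)
    (hΓ.preimage_translate f g)
  rw [M.inducedSetoid_pullback hg.2] at h
  obtain ⟨R, hmin, hmax, hR⟩ := h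
  exact ⟨R, hmin, fun e a b hab => M.maxRel_of_maxRel_pullback hg.2 Γ (hmax e a b hab), hR⟩

theorem admitsDefinableFiltration_fusion {I : Type} {A : I → Type} [Countable (Σ i, A i)]
    {L : ∀ i, ModalLogic (A i)} (hL : ∀ i, AdmitsStrictFiltration (L i).frames) :
    AdmitsDefinableFiltration {M | M.frame ∈ (fusion L).frames} (fusion L).frames := by
  intro Γ hfin hΓ M hM
  choose R hmin hmax hR using fun i =>
    (hL i).exists_rel_reduct sigma_mk_injective (mem_frames_fusion.1 hM i) hfin hΓ
  exact ⟨.ofRel (M.inducedSetoid Γ) (M.finite_quotient_inducedSetoid hfin) le_rfl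
    (fun e => R e.1 e.2) (fun e => hmin e.1 e.2) (fun e => hmax e.1 e.2),
    Model.isDefinable_inducedSetoid_class hfin, mem_frames_fusion.2 hR⟩

end Filtration

/-! ### PDL-like expansions -/

section PDL

variable {A : Type}

theorem Sharp.base_injective : Function.Injective (Sharp.base : A → Sharp A) :=
  fun _ _ h => Sharp.base.inj h

instance [Countable A] : Countable (Sharp A) := by
  let encode : Sharp A → Fin 4 × A × A
    | .base e => (0, e, e)
    | .comp e c => (1, e, c)
    | .union e c => (2, e, c)
    | .plus e => (3, e, e)
  refine Function.Injective.countable (f := encode) ?_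
  rintro (_ | _ | _ | _) (_ | _ | _ | _) h <;> simp_all [encode]

/-- The standard interpretation of the symbols of `A♯`, given one of the symbols of `A`. -/
def sharpRel {W : Type} (R : A → W → W → Prop) : Sharp A → W → W → Prop
  | .base e => R e
  | .comp e c => Relation.Comp (R e) (R c)
  | .union e c => fun x y => R e x y ∨ R c x y
  | .plus e => Relation.TransGen (R e)

/-- The standard expansion of a frame to the alphabet `A♯`. -/
def Frame.sharp (F : Frame A) : Frame (Sharp A) where
  World := F.World
  nonempty := F.nonempty
  rel := sharpRel F.rel

theorem PDLAxiom.valid_sharp {φ : Form (Sharp A)} (h : PDLAxiom φ) (F : Frame A) :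
    F.sharp.Valid φ := by
  intro V x
  cases h with
  | union e c =>
    rw [Model.sat_iff, Model.sat_and]
    exact ⟨fun h => ⟨fun y hy => h y (Or.inl hy), fun y hy => h y (Or.inr hy)⟩,
      fun h y hy => hy.elim (h.1 y) (h.2 y)⟩
  | comp e c =>
    rw [Model.sat_iff]
    exact ⟨fun h z hz y hy => h y ⟨z, hz, hy⟩, fun h y ⟨z, hz, hy⟩ => h z hz y hy⟩
  | plus_one e => exact fun h y hy => h y (.single hy)
  | plus_step e => exact fun h z hz y hy => h y (.head hz hy)
  | plus_ind e =>
    intro hstep hone y hy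
    induction hy with
    | single hy => exact hone _ hy
    | tail hy hz ih => exact hstep _ hy ih _ hz

theorem Frame.sharp_mem_frames {L : ModalLogic A} {F : Frame A} (hF : F ∈ L.frames) :
    F.sharp ∈ L.sharp.frames := by
  refine ModalLogic.mem_frames_generate.2 ?_
  rintro φ (⟨ψ, hψ, rfl⟩ | hφ)
  · exact (F.sharp.valid_rename _ ψ).2 (hF ψ hψ)
  · exact hφ.valid_sharp F

theorem ModalLogic.sharp_extends (L : ModalLogic A) : L.sharp.Extends Sharp.base L :=
  fun φ hφ => subset_generate _ (Or.inl ⟨φ, hφ, rfl⟩)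

/-- Truth in a model of all substitution instances of the PDL-like axioms. -/
structure Model.IsPDL (M : Model (Sharp A)) : Prop where
  union : ∀ e c φ x, M.Sat x (.box (.union e c) φ) ↔
    M.Sat x (.box (.base e) φ) ∧ M.Sat x (.box (.base c) φ)
  comp : ∀ e c φ x, M.Sat x (.box (.comp e c) φ) ↔ M.Sat x (.box (.base e) (.box (.base c) φ))
  plus_one : ∀ e φ x, M.Sat x (.box (.plus e) φ) → M.Sat x (.box (.base e) φ)
  plus_step : ∀ e φ x, M.Sat x (.box (.plus e) φ) → M.Sat x (.box (.base e) (.box (.plus e) φ))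
  plus_ind : ∀ e φ x, M.Sat x (.box (.plus e) (.imp φ (.box (.base e) φ))) →
    M.Sat x (.box (.base e) φ) → M.Sat x (.box (.plus e) φ)

theorem Model.isPDL_of_mem_models_sharp {L : ModalLogic A} {M : Model (Sharp A)}
    (hM : M ∈ L.sharp.models) : M.IsPDL := by
  have sat_subst {χ : Form (Sharp A)} (hχ : PDLAxiom χ) (φ x) : M.Sat x (χ.subst fun _ => φ) :=
    hM _ (L.sharp.subst _ _ (ModalLogic.subset_generate _ (Or.inr hχ))) x
  refine ⟨fun e c φ x => ?_, fun e c φ x => ?_, fun e => sat_subst (.plus_one e),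
    fun e => sat_subst (.plus_step e), fun e => sat_subst (.plus_ind e)⟩
  · rw [← Model.sat_and, ← Model.sat_iff]
    exact sat_subst (.union e c) φ x
  · rw [← Model.sat_iff]
    exact sat_subst (.comp e c) φ x

theorem Model.IsPDL.sharpRel_of_minRel {M : Model (Sharp A)} (hM : M.IsPDL)
    {s : Setoid M.frame.World} (hs : ∀ Q : Set (Quotient s), M.IsDefinable (Quotient.mk s ⁻¹' Q))
    {R : A → Quotient s → Quotient s → Prop}
    (hR : ∀ e a b, M.minRel s (.base e) a b → R e a b) (e : Sharp A) (a b : Quotient s)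
    (h : M.minRel s e a b) : sharpRel R e a b := by
  obtain ⟨x, y, rfl, rfl, hxy⟩ := h
  have step (e z w) (hzw : M.frame.rel (.base e) z w) : R e (Quotient.mk s z) (Quotient.mk s w) :=
    hR e _ _ ⟨z, w, rfl, rfl, hzw⟩
  obtain ⟨ψ, hψ⟩ := hs {a | sharpRel R e (Quotient.mk s x) a}
  suffices hbox : M.Sat x (.box e ψ) from (hψ y).1 (hbox y hxy)
  cases e with
  | base e => exact fun z hz => (hψ z).2 (step e x z hz)
  | comp e c =>
    rw [hM.comp]
    exact fun z hz w hw => (hψ w).2 ⟨_, step e x z hz, step c z w hw⟩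
  | union e c =>
    rw [hM.union]
    exact ⟨fun z hz => (hψ z).2 (Or.inl (step e x z hz)),
      fun z hz => (hψ z).2 (Or.inr (step c x z hz))⟩
  | plus e =>
    refine hM.plus_ind e ψ x (fun z _ hz w hw => ?_) fun z hz => ?_
    · exact (hψ w).2 (Relation.TransGen.tail ((hψ z).1 hz) (step e z w hw))
    · exact (hψ z).2 (Relation.TransGen.single (step e x z hz))

/-- The formulas over which the axioms of `A♯` unfold a boxed formula: a relation that respects
them on the base modalities respects the boxed formula in its standard expansion. -/
def Form.unfoldings : Form (Sharp A) → Set (Form (Sharp A))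
  | .box (.comp e c) φ => {.box (.base e) (.box (.base c) φ)}
  | .box (.union e c) φ => {.box (.base e) φ, .box (.base c) φ}
  | .box (.plus e) φ => {.box (.base e) φ, .box (.base e) (.box (.plus e) φ)}
  | _ => ∅

theorem Form.unfoldings_finite (φ : Form (Sharp A)) : φ.unfoldings.Finite := by
  unfold Form.unfoldings
  split <;> exact Set.toFinite _

theorem exists_finite_subClosed_superset_unfoldings {Γ : Set (Form (Sharp A))} (hΓ : Γ.Finite) :
    ∃ Δ : Set (Form (Sharp A)), Δ.Finite ∧ SubClosed Δ ∧ Γ ⊆ Δ ∧ ∀ φ ∈ Γ, φ.unfoldings ⊆ Δ := by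
  obtain ⟨Δ, hfin, hΔ, hsub⟩ := exists_finite_subClosed_superset
    (hΓ.union (hΓ.biUnion fun φ _ => φ.unfoldings_finite))
  obtain ⟨hΓΔ, hunfold⟩ := Set.union_subset_iff.1 hsub
  exact ⟨Δ, hfin, hΔ, hΓΔ, Set.iUnion₂_subset_iff.1 hunfold⟩

theorem Model.IsPDL.sat_box_plus_of_transGen {M : Model (Sharp A)} (hM : M.IsPDL)
    {Δ : Set (Form (Sharp A))} {s : Setoid M.frame.World} {e : A} {φ : Form (Sharp A)}
    (hφ : (Form.box (.plus e) φ).unfoldings ⊆ Δ) {r : Quotient s → Quotient s → Prop}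
    (hr : ∀ a b, r a b → M.maxRel Δ s (.base e) a b) {x : M.frame.World}
    (hx : M.Sat x (.box (.plus e) φ)) {b : Quotient s}
    (h : Relation.TransGen r (Quotient.mk s x) b) (y : M.frame.World) (hy : Quotient.mk s y = b) :
    M.Sat y φ ∧ M.Sat y (.box (.plus e) φ) := by
  have step (z w) (hzw : r (Quotient.mk s z) (Quotient.mk s w)) (hz : M.Sat z (.box (.plus e) φ)) :
      M.Sat w φ ∧ M.Sat w (.box (.plus e) φ) :=
    ⟨hr _ _ hzw z w rfl rfl _ (hφ (Or.inl rfl)) (hM.plus_one e φ z hz),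
      hr _ _ hzw z w rfl rfl _ (hφ (Or.inr rfl)) (hM.plus_step e φ z hz)⟩
  induction h generalizing y with
  | single hxb => subst hy; exact step x y hxb hx
  | @tail a _ _ hab ih =>
    subst hy
    obtain ⟨z, rfl⟩ := Quotient.exists_rep a
    exact step z y hab (ih z rfl).2

theorem Model.IsPDL.maxRel_of_sharpRel {M : Model (Sharp A)} (hM : M.IsPDL)
    {Γ Δ : Set (Form (Sharp A))} (hΓ : Γ ⊆ Δ) (hunfold : ∀ φ ∈ Γ, φ.unfoldings ⊆ Δ)
    (hΔ : SubClosed Δ) {s : Setoid M.frame.World} {R : A → Quotient s → Quotient s → Prop}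
    (hR : ∀ e a b, R e a b → M.maxRel Δ s (.base e) a b) (e : Sharp A) (a b : Quotient s)
    (h : sharpRel R e a b) : M.maxRel Γ s e a b := by
  rintro x y rfl rfl φ hφ hx
  have hunfold := hunfold _ hφ
  cases e with
  | base e => exact hR e _ _ h x y rfl rfl φ (hΓ hφ) hx
  | comp e c =>
    have hmem : Form.box (.base e) (.box (.base c) φ) ∈ Δ := hunfold rfl
    obtain ⟨d, hxd, hdy⟩ := h
    obtain ⟨z, rfl⟩ := Quotient.exists_rep d
    have hz := hR e _ _ hxd x z rfl rfl _ hmem ((hM.comp e c φ x).1 hx)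
    exact hR c _ _ hdy z y rfl rfl φ (hΔ _ hmem (Or.inr (Form.mem_subformulas_self _))) hz
  | union e c =>
    obtain ⟨he, hc⟩ := (hM.union e c φ x).1 hx
    rcases h with h | h
    · exact hR e _ _ h x y rfl rfl φ (hunfold (Or.inl rfl)) he
    · exact hR c _ _ h x y rfl rfl φ (hunfold (Or.inr rfl)) hc
  | plus e => exact (hM.sat_box_plus_of_transGen hunfold (hR e) hx h y rfl).1

theorem AdmitsDefinableFiltration.sharp [Countable A] {𝓜 : Set (Model A)} {C : Set (Frame A)}
    (h : AdmitsDefinableFiltration 𝓜 C) :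
    AdmitsDefinableFiltration {M | M.IsPDL ∧ ∀ g, M.pullback Sharp.base g ∈ 𝓜}
      (Frame.sharp '' C) := by
  rintro Γ hfin - M ⟨hPDL, hM⟩
  obtain ⟨Δ, hΔfin, hΔ, hΓΔ, hunfold⟩ := exists_finite_subClosed_superset_unfoldings hfin
  obtain ⟨g, hg⟩ := Form.exists_translate_bijective (Sharp.base_injective (A := A))
  obtain ⟨f, hdef, hf⟩ := h _ (hΔfin.preimage hg.1.injOn)
    (hΔ.preimage_translate Sharp.base g) _ (hM g)
  have hrespects : f.equiv ≤ M.inducedSetoid Γ := by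
    refine le_trans ?_ (M.inducedSetoid_anti hΓΔ)
    rw [← M.inducedSetoid_pullback hg.2]
    exact @f.respects
  have hmin := hPDL.sharpRel_of_minRel (fun Q => (hdef.preimage Q).of_pullback) f.min_le
  have hmax := hPDL.maxRel_of_sharpRel hΓΔ hunfold hΔ fun e a b hab =>
    M.maxRel_of_maxRel_pullback hg.2 Δ (f.le_max e a b hab)
  exact ⟨.ofRel f.equiv f.finite_index hrespects (sharpRel f.rel) hmin hmax,
    fun a => (hdef a).of_pullback, f.frame, hf, rfl⟩

end PDL

/-! ### Iterated expansions -/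

section SharpIter

variable {A : Type}

/-- The embedding of `A` into its iterated expansions. -/
def SharpIter.base : (n : ℕ) → A → SharpIter A n
  | 0 => id
  | n + 1 => Sharp.base ∘ SharpIter.base n

theorem SharpIter.base_injective (n : ℕ) : Function.Injective (SharpIter.base (A := A) n) := by
  induction n with
  | zero => exact Function.injective_id
  | succ n ih => exact Sharp.base_injective.comp ih

instance [Countable A] (n : ℕ) : Countable (SharpIter A n) := by
  induction n with
  | zero => assumption
  | succ n ih => exact inferInstanceAs (Countable (Sharp (SharpIter A n)))

theorem ModalLogic.sharpIter_extends (L : ModalLogic A) (n : ℕ) :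
    (L.sharpIter n).Extends (SharpIter.base n) L := by
  induction n with
  | zero => exact L.extends_id
  | succ n ih => exact (L.sharpIter n).sharp_extends.trans ih

theorem AdmitsDefinableFiltration.sharpIter [Countable A] {L : ModalLogic A} {K : Set (Frame A)}
    (h : AdmitsDefinableFiltration {M | M.frame ∈ K ∧ M ∈ L.models} L.frames) (n : ℕ) :
    AdmitsDefinableFiltration
      {M | M.frame.reduct (SharpIter.base n) ∈ K ∧ M ∈ (L.sharpIter n).models}
      (L.sharpIter n).frames := by
  induction n with
  | zero => exact h
  | succ n ih =>
    refine ih.sharp.mono ?_ (Set.image_subset_iff.2 fun F => Frame.sharp_mem_frames)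
    rintro M ⟨hK, hM⟩
    exact ⟨Model.isPDL_of_mem_models_sharp hM, fun g =>
      ⟨hK, (L.sharpIter n).sharp_extends.pullback_mem_models hM g⟩⟩

end SharpIter

end ModalPDL

open ModalPDL in
theorem mainTheorem5_general {I : Type} {A : I → Type} [Countable (Σ i, A i)]
    (L : ∀ i, ModalLogic (A i)) (hcanonical : ∀ i, (L i).IsCanonical)
    (hfiltration : ∀ i, AdmitsStrictFiltration (L i).frames) (n : ℕ) :
    ((fusion L).sharpIter n).HasFMP := by
  refine ModalLogic.hasFMP_of_filtration fun h Γ hfin hΓ => ?_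
  have hreduct : (((fusion L).sharpIter n).canonicalFrame h).reduct (SharpIter.base n) ∈
      (fusion L).frames := mem_frames_fusion.2 fun i =>
    (hcanonical i).reduct_canonicalFrame_mem_frames
      (((fusion L).sharpIter_extends n).trans (fusion_extends L i))
      ((SharpIter.base_injective n).comp sigma_mk_injective) h
  have hfusion : AdmitsDefinableFiltration
      {M | M.frame ∈ (fusion L).frames ∧ M ∈ (fusion L).models} (fusion L).frames :=
    (admitsDefinableFiltration_fusion hfiltration).mono (fun _ hM => hM.1) subset_rfl
  obtain ⟨f, -, hf⟩ := hfusion.sharpIter n Γ hfin hΓ _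
    ⟨hreduct, ModalLogic.canonicalModel_mem_models _ h⟩
  exact ⟨f, hf⟩

theorem mainTheorem5 (k : ℕ) (A : Fin k → Type) [∀ i, Finite (A i)]
    (L : ∀ i, ModalPDL.ModalLogic (A i))
    (hcanonical : ∀ i, (L i).IsCanonical)
    (hfiltration : ∀ i, ModalPDL.AdmitsStrictFiltration (L i).frames)
    (n : ℕ) :
    ((ModalPDL.fusion L).sharpIter n).HasFMP :=
  mainTheorem5_general L hcanonical hfiltration n
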